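/- Let $K\subset\mathbb R^d$ be a convex cone that is closed, solid (has nonempty interior) and pointed (contains no straight line), and let $A$ be a linear operator on $\mathbb R^d$ with $AK\subset K$. A face of $K$ is a convex cone $F\subset K$ containing $0$ such that $x,y\in K$ and $x+y\in F$ imply $x,y\in F$. Let $\Gamma\subset K$ be nonempty, and let $L$ be the minimal invariant face for $\Gamma$, i.e. the smallest by inclusion face of $K$ that contains $\Gamma$ and satisfies $AL\subset L$. Let $\rho=\rho(A|_L)$ be the spectral radius (the largest modulus of a complex eigenvalue) of the restriction of $A$ to the linear span of $L$, with $\rho=0$ if $L=\{0\}$. Then: 1. If $\rho>0$, then for every $x\in\Gamma$ there are constants $r>0$ and $C>0$ such that $\|A^jx\|\le C\,j^{\,r}\rho^{\,j}$ for all integers $j\ge 1$. If $\rho=0$, then $A^jx=0$ for all $x\in\Gamma$ and all $j\ge d$. 2. There are $x_0\in\Gamma$ and $C>0$ such that $\|A^jx_0\|\ge C\,\rho^{\,j}$ for all integers $j\ge 1$. -/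

import Mathlib

/-- The spectral radius of a linear operator `B` on a real vector space `V`: the largest modulus of
a *complex* eigenvalue, i.e. the spectral radius of the complexification of `B` (a real number,
equal to `0` when `V` is zero-dimensional). -/
noncomputable def opSpectralRadius {V : Type*} [AddCommGroup V] [Module ℝ V]
    (B : V →ₗ[ℝ] V) : ℝ :=
  (spectralRadius ℂ (LinearMap.baseChange ℂ B : Module.End ℂ (TensorProduct ℝ ℂ V))).toReal

/-- `F` is a face of the cone `K`, and the operator `A` maps `F` into itself. Faces are the usual
faces of convex geometry (Mathlib's `PointedCone.IsFaceOf`): subcones `F` of `K` such that a sum of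
two elements of `K` lies in `F` only if both summands do. -/
def IsInvariantFace {E : Type*} [AddCommGroup E] [Module ℝ E]
    (K : PointedCone ℝ E) (A : E →ₗ[ℝ] E) (F : PointedCone ℝ E) : Prop :=
  F.IsFaceOf K ∧ ∀ x ∈ F, A x ∈ F

/-- `L` is the minimal invariant face for `Γ`: the smallest by inclusion among the `A`-invariant
faces of `K` that contain `Γ`. -/
def IsMinimalInvariantFace {E : Type*} [AddCommGroup E] [Module ℝ E]
    (K : PointedCone ℝ E) (A : E →ₗ[ℝ] E) (Γ : Set E) (L : PointedCone ℝ E) : Prop :=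
  IsLeast {F : PointedCone ℝ E | IsInvariantFace K A F ∧ Γ ⊆ (F : Set E)} L

/-- The minimal invariant face exists for every subset of an invariant cone. -/
theorem exists_isMinimalInvariantFace {E : Type*} [AddCommGroup E] [Module ℝ E]
    (K : PointedCone ℝ E) (A : E →ₗ[ℝ] E) (hA : ∀ x ∈ K, A x ∈ K)
    (Γ : Set E) (hΓ : Γ ⊆ (K : Set E)) : ∃ L, IsMinimalInvariantFace K A Γ L := by
  have hK : K ∈ {F : PointedCone ℝ E | IsInvariantFace K A F ∧ Γ ⊆ (F : Set E)} :=
    ⟨⟨⟨le_rfl, fun hx _ _ _ => hx⟩, hA⟩, hΓ⟩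
  refine ⟨sInf {F : PointedCone ℝ E | IsInvariantFace K A F ∧ Γ ⊆ (F : Set E)},
    ⟨⟨⟨sInf_le hK, ?_⟩, ?_⟩, ?_⟩, fun F hF => sInf_le hF⟩
  · intro x y a hx hy ha h
    rw [Submodule.mem_sInf] at h ⊢
    exact fun F hF => hF.1.1.mem_of_smul_add_mem hx hy ha (h F hF)
  · intro x h
    rw [Submodule.mem_sInf] at h ⊢
    exact fun F hF => hF.1.2 x (h F hF)
  · intro x hx
    rw [SetLike.mem_coe, Submodule.mem_sInf]
    exact fun F hF => hF.2 hx

/-- The linear span of an invariant face is an invariant subspace. -/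
theorem IsInvariantFace.span_invariant {E : Type*} [AddCommGroup E] [Module ℝ E]
    {K : PointedCone ℝ E} {A : E →ₗ[ℝ] E} {F : PointedCone ℝ E} (h : IsInvariantFace K A F) :
    ∀ x ∈ Submodule.span ℝ (F : Set E), A x ∈ Submodule.span ℝ (F : Set E) := by
  intro x hx
  have hle : Submodule.span ℝ (F : Set E) ≤ (Submodule.span ℝ (F : Set E)).comap A :=
    Submodule.span_le.2 fun y hy => Submodule.subset_span (h.2 y hy)
  exact hle hx

/-- `ρ(A|_F)`: the spectral radius of the restriction of `A` to the face plane of the invariant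
face `F`, i.e. to the linear span of `F`. -/
noncomputable def faceSpectralRadius {E : Type*} [AddCommGroup E] [Module ℝ E]
    {K : PointedCone ℝ E} {A : E →ₗ[ℝ] E} {F : PointedCone ℝ E} (h : IsInvariantFace K A F) : ℝ :=
  opSpectralRadius (A.restrict h.span_invariant)

/-! Write `B` for the restriction of `A` to the span of `L`. The upper bounds are linear algebra:
the complexification of `B` splits into generalized eigenspaces, where orbits grow at most
polynomially times `ρ ^ j`; if `ρ = 0`, then `B` is nilpotent.

The lower bound is a dual Perron-Frobenius argument. Since `B` preserves the generating cone `L`,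
there is a nonzero functional `f ≥ 0` on `L` with `f ∘ B = ρ f` (`exists_nonneg_eigenfunctional`).
The zeros of `f` in `L` form an invariant face, so by minimality `f` cannot vanish on all of `Γ`; if
`f x₀ > 0`, then `f (A ^ j x₀) = ρ ^ j * f x₀` bounds the orbit of `x₀` from below.

To build `f`, take `φ` dominating the norm on `K` and normalize the Abel sums `F_s = ∑ s ^ j φ ∘ B ^
j`. They satisfy `s F_s ∘ B = F_s - φ` and blow up as `s ↑ 1 / ρ`, so `φ` disappears from the limit.
-/

open Module Filter Topology
open scoped TensorProduct

/-- A real sequence growing at most like `ρ a j + C (j+1)^k ρ^j` gains one power of `j`. -/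
theorem le_mul_succ_pow_of_le_mul_add {a : ℕ → ℝ} {ρ C : ℝ} {k : ℕ} (hρ : 0 < ρ) (hC : 0 ≤ C)
    (h : ∀ j, a (j + 1) ≤ ρ * a j + C * ((j : ℝ) + 1) ^ k * ρ ^ j) :
    ∀ j : ℕ, a j ≤ (|a 0| + C / ρ) * ((j : ℝ) + 1) ^ (k + 1) * ρ ^ j := by
  intro j
  induction j with
  | zero =>
    have := le_abs_self (a 0)
    have : 0 ≤ C / ρ := by positivity
    simp only [Nat.cast_zero, zero_add, one_pow, pow_zero, mul_one]
    linarith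
  | succ j ih =>
    have hD : C / ρ ≤ |a 0| + C / ρ := by linarith [abs_nonneg (a 0)]
    set D := |a 0| + C / ρ
    have hD0 : 0 ≤ D := le_trans (by positivity) hD
    have hC' : C ≤ D * ρ := by rwa [div_le_iff₀ hρ] at hD
    have hpow : ((j : ℝ) + 1) ^ (k + 1) + ((j : ℝ) + 1) ^ k ≤ ((j : ℝ) + 1 + 1) ^ (k + 1) := by
      have : ((j : ℝ) + 1) ^ k ≤ ((j : ℝ) + 1 + 1) ^ k := by gcongr; linarith
      calc ((j : ℝ) + 1) ^ (k + 1) + ((j : ℝ) + 1) ^ k = ((j : ℝ) + 1) ^ k * ((j : ℝ) + 1 + 1) := by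
            ring
        _ ≤ ((j : ℝ) + 1 + 1) ^ k * ((j : ℝ) + 1 + 1) := by gcongr
        _ = _ := by ring
    calc a (j + 1) ≤ ρ * a j + C * ((j : ℝ) + 1) ^ k * ρ ^ j := h j
      _ ≤ ρ * (D * ((j : ℝ) + 1) ^ (k + 1) * ρ ^ j) + (D * ρ) * ((j : ℝ) + 1) ^ k * ρ ^ j := by
          gcongr
      _ = D * (((j : ℝ) + 1) ^ (k + 1) + ((j : ℝ) + 1) ^ k) * ρ ^ (j + 1) := by ring
      _ ≤ D * ((j : ℝ) + 1 + 1) ^ (k + 1) * ρ ^ (j + 1) := by gcongr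
      _ = _ := by push_cast; ring

/-! ### Growth of orbits and left eigenvectors over `ℂ`. -/

section Complex

variable {W : Type*} [AddCommGroup W] [Module ℂ W] (T : End ℂ W)

/-- Induction on the order: `T - μ` lowers it by one, and the resulting recursion costs one power of
`j`. Sizes are measured through a functional `g` because `W` carries no norm. -/
theorem exists_norm_apply_pow_le_of_mem_genEigenspace {ρ : ℝ} (hρ : 0 < ρ) {μ : ℂ} (hμ : ‖μ‖ ≤ ρ)
    (g : W →ₗ[ℂ] ℂ) (k : ℕ) :
    ∀ v ∈ T.genEigenspace μ (k : ℕ∞), ∃ C : ℝ, 0 ≤ C ∧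
      ∀ j : ℕ, ‖g ((T ^ j) v)‖ ≤ C * ((j : ℝ) + 1) ^ k * ρ ^ j := by
  induction k with
  | zero =>
    intro v hv
    rw [End.mem_genEigenspace_nat, pow_zero, LinearMap.mem_ker, End.one_apply] at hv
    exact ⟨0, le_rfl, fun j => by simp [hv]⟩
  | succ k ih =>
    intro v hv
    rw [End.mem_genEigenspace_nat, pow_succ, LinearMap.mem_ker, End.mul_apply] at hv
    obtain ⟨C, hC, hb⟩ := ih ((T - μ • 1) v) (by
      rwa [End.mem_genEigenspace_nat, LinearMap.mem_ker])
    refine ⟨|‖g ((T ^ 0) v)‖| + C / ρ, by positivity,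
      le_mul_succ_pow_of_le_mul_add (a := fun j => ‖g ((T ^ j) v)‖) hρ hC fun j => ?_⟩
    have hTv : T v = μ • v + (T - μ • 1) v := by simp
    have : g ((T ^ (j + 1)) v) = μ * g ((T ^ j) v) + g ((T ^ j) ((T - μ • 1) v)) := by
      rw [pow_succ, End.mul_apply, hTv, map_add, map_add, map_smul, map_smul, smul_eq_mul]
    calc ‖g ((T ^ (j + 1)) v)‖ ≤ ‖μ‖ * ‖g ((T ^ j) v)‖ + ‖g ((T ^ j) ((T - μ • 1) v))‖ := by
          rw [this, ← norm_mul]; exact norm_add_le _ _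
      _ ≤ _ := by gcongr; exact hb j

theorem mem_spectrum_of_mem_genEigenspace {μ : ℂ} {k : ℕ} {v : W}
    (hv : v ∈ T.genEigenspace μ (k : ℕ∞)) (h0 : v ≠ 0) : μ ∈ spectrum ℂ T :=
  (End.hasEigenvalue_of_hasGenEigenvalue (k := k)
    (End.HasUnifEigenvector.hasUnifEigenvalue ⟨hv, h0⟩)).mem_spectrum

variable [FiniteDimensional ℂ W]

theorem exists_norm_apply_pow_le {ρ : ℝ} (hρ : 0 < ρ) (hμ : ∀ μ ∈ spectrum ℂ T, ‖μ‖ ≤ ρ)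
    (g : W →ₗ[ℂ] ℂ) (v : W) :
    ∃ C : ℝ, 0 ≤ C ∧ ∀ j : ℕ, ‖g ((T ^ j) v)‖ ≤ C * ((j : ℝ) + 1) ^ finrank ℂ W * ρ ^ j := by
  have hv : v ∈ ⨆ μ, T.maxGenEigenspace μ := by
    rw [End.iSup_maxGenEigenspace_eq_top]; trivial
  refine Submodule.iSup_induction _ (motive := fun v => ∃ C : ℝ, 0 ≤ C ∧
    ∀ j : ℕ, ‖g ((T ^ j) v)‖ ≤ C * ((j : ℝ) + 1) ^ finrank ℂ W * ρ ^ j) hv ?_ ?_ ?_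
  · intro μ v hv
    by_cases h0 : v = 0
    · exact ⟨0, le_rfl, fun j => by simp [h0]⟩
    · rw [End.maxGenEigenspace_eq_genEigenspace_finrank] at hv
      refine exists_norm_apply_pow_le_of_mem_genEigenspace T hρ (hμ μ ?_) g _ v hv
      exact mem_spectrum_of_mem_genEigenspace T hv h0
  · exact ⟨0, le_rfl, fun j => by simp⟩
  · rintro v w ⟨C, hC, hb⟩ ⟨D, hD, hd⟩
    refine ⟨C + D, by positivity, fun j => ?_⟩
    rw [map_add, map_add]
    calc _ ≤ ‖g ((T ^ j) v)‖ + ‖g ((T ^ j) w)‖ := norm_add_le _ _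
      _ ≤ _ := by rw [add_mul, add_mul]; exact add_le_add (hb j) (hd j)

/-- The spectrum is finite, so the supremum is not `⊤` and `toReal` loses nothing. -/
theorem norm_le_toReal_spectralRadius {μ : ℂ} (hμ : μ ∈ spectrum ℂ T) :
    ‖μ‖ ≤ (spectralRadius ℂ T).toReal := by
  have hfin : spectralRadius ℂ T ≠ ⊤ := by
    obtain ⟨M, hM⟩ := ((End.finite_spectrum T).image (fun k : ℂ => ‖k‖₊)).bddAbove
    refine ne_top_of_le_ne_top (b := (M : ENNReal)) ENNReal.coe_ne_top (iSup₂_le fun k hk => ?_)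
    exact_mod_cast hM ⟨k, hk, rfl⟩
  have : (‖μ‖₊ : ENNReal) ≤ spectralRadius ℂ T :=
    le_iSup₂ (f := fun (k : ℂ) (_ : k ∈ spectrum ℂ T) => (‖k‖₊ : ENNReal)) μ hμ
  simpa using ENNReal.toReal_mono hfin this

theorem exists_mem_spectrum_norm_eq (h : 0 < (spectralRadius ℂ T).toReal) :
    ∃ μ ∈ spectrum ℂ T, ‖μ‖ = (spectralRadius ℂ T).toReal := by
  have hne : (spectrum ℂ T).Nonempty := by
    rw [Set.nonempty_iff_ne_empty]
    intro h0
    simp [spectralRadius, h0] at h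
  obtain ⟨μ, hμ, hmax⟩ := (End.finite_spectrum T).exists_maximalFor (fun k : ℂ => ‖k‖₊) _ hne
  refine ⟨μ, hμ, le_antisymm (norm_le_toReal_spectralRadius T hμ) ?_⟩
  have : spectralRadius ℂ T ≤ (‖μ‖₊ : ENNReal) := iSup₂_le fun k hk => by
    rcases le_total ‖k‖₊ ‖μ‖₊ with h | h
    · exact_mod_cast h
    · exact_mod_cast hmax hk h
  simpa using ENNReal.toReal_mono ENNReal.coe_ne_top this

theorem pow_finrank_eq_zero_of_spectralRadius_eq_zero (h : (spectralRadius ℂ T).toReal = 0) :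
    T ^ finrank ℂ W = 0 := by
  ext v
  have hv : v ∈ ⨆ μ, T.maxGenEigenspace μ := by
    rw [End.iSup_maxGenEigenspace_eq_top]; trivial
  refine Submodule.iSup_induction _ (motive := fun v => (T ^ finrank ℂ W) v = 0) hv ?_ ?_ ?_
  · intro μ v hv
    by_cases h0 : v = 0
    · simp [h0]
    · rw [End.maxGenEigenspace_eq_genEigenspace_finrank] at hv
      have hμ : μ ∈ spectrum ℂ T := mem_spectrum_of_mem_genEigenspace T hv h0
      have := norm_le_toReal_spectralRadius T hμ
      rw [h, norm_le_zero_iff] at this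
      simpa [End.mem_genEigenspace_nat, this] using hv
  · simp
  · intro v w hv hw
    rw [map_add, hv, hw, add_zero]

/-- In finite dimension `μ - T` is not surjective, and any nonzero functional killing its range is a
left eigenvector. -/
theorem exists_ne_zero_comp_eq_smul {μ : ℂ} (hμ : μ ∈ spectrum ℂ T) :
    ∃ g : W →ₗ[ℂ] ℂ, g ≠ 0 ∧ ∀ v, g (T v) = μ * g v := by
  have hlt : LinearMap.range (algebraMap ℂ (End ℂ W) μ - T) < ⊤ := by
    rw [lt_top_iff_ne_top]
    intro h
    exact hμ ((LinearMap.isUnit_iff_range_eq_top _).2 h)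
  obtain ⟨g, hg, hle⟩ := Submodule.exists_le_ker_of_lt_top _ hlt
  refine ⟨g, hg, fun v => ?_⟩
  have := hle (LinearMap.mem_range_self _ v)
  rw [LinearMap.mem_ker, LinearMap.sub_apply, map_sub, algebraMap_end_apply, map_smul,
    smul_eq_mul, sub_eq_zero] at this
  exact this.symm

end Complex

/-! ### Transfer to real operators through the complexification. -/

section Real

variable {V : Type*} [AddCommGroup V] [Module ℝ V] (B : V →ₗ[ℝ] V)

theorem opSpectralRadius_nonneg : 0 ≤ opSpectralRadius B := ENNReal.toReal_nonneg

theorem baseChange_pow_one_tmul (j : ℕ) (x : V) :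
    (((LinearMap.baseChange ℂ B : End ℂ (ℂ ⊗[ℝ] V)) ^ j) ((1 : ℂ) ⊗ₜ[ℝ] x)) =
      (1 : ℂ) ⊗ₜ[ℝ] ((B ^ j) x) := by
  rw [← LinearMap.baseChange_pow, LinearMap.baseChange_tmul]

variable [FiniteDimensional ℝ V]

/-- Every complex eigenvalue of maximal modulus has a complex-valued left eigenvector. -/
theorem exists_complex_left_eigenvector (h : 0 < opSpectralRadius B) :
    ∃ (μ : ℂ) (g : V →ₗ[ℝ] ℂ), ‖μ‖ = opSpectralRadius B ∧ g ≠ 0 ∧ ∀ x, g (B x) = μ * g x := by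
  obtain ⟨μ, hμ, hn⟩ := exists_mem_spectrum_norm_eq (LinearMap.baseChange ℂ B) h
  obtain ⟨g, hg, hB⟩ := exists_ne_zero_comp_eq_smul _ hμ
  -- The restriction of `g` to the vectors `1 ⊗ x` is nonzero because these span the
  -- complexification over `ℂ`.
  refine ⟨μ, (g.restrictScalars ℝ) ∘ₗ TensorProduct.mk ℝ ℂ V 1, hn, fun h0 => hg ?_, fun x => ?_⟩
  · apply TensorProduct.AlgebraTensorModule.curry_injective
    ext x
    simpa using LinearMap.congr_fun h0 x
  · simpa using hB (1 ⊗ₜ x)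

theorem pow_finrank_eq_zero_of_opSpectralRadius_eq_zero (h : opSpectralRadius B = 0) :
    B ^ finrank ℝ V = 0 := by
  have hp := pow_finrank_eq_zero_of_spectralRadius_eq_zero (LinearMap.baseChange ℂ B) h
  rw [finrank_baseChange] at hp
  ext x
  have := baseChange_pow_one_tmul B (finrank ℝ V) x
  rw [hp, LinearMap.zero_apply] at this
  refine (finBasis ℝ V).repr.injective (Finsupp.ext fun i => ?_)
  simpa using (congrArg ((Algebra.TensorProduct.basis ℂ (finBasis ℝ V)).coord i) this).symm

end Real

theorem exists_norm_pow_apply_le {V : Type*} [NormedAddCommGroup V] [NormedSpace ℝ V]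
    [FiniteDimensional ℝ V] (B : V →ₗ[ℝ] V) (h : 0 < opSpectralRadius B) (x : V) :
    ∃ C : ℝ, 0 ≤ C ∧ ∀ j : ℕ,
      ‖(B ^ j) x‖ ≤ C * ((j : ℝ) + 1) ^ finrank ℝ V * opSpectralRadius B ^ j := by
  let b := finBasis ℝ V
  have hcoord : ∀ i, ∃ C : ℝ, 0 ≤ C ∧ ∀ j : ℕ,
      |b.repr ((B ^ j) x) i| ≤ C * ((j : ℝ) + 1) ^ finrank ℝ V * opSpectralRadius B ^ j := by
    intro i
    obtain ⟨C, hC, hb⟩ := exists_norm_apply_pow_le (LinearMap.baseChange ℂ B) h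
      (fun μ hμ => norm_le_toReal_spectralRadius _ hμ)
      ((Algebra.TensorProduct.basis ℂ b).coord i) (1 ⊗ₜ x)
    refine ⟨C, hC, fun j => ?_⟩
    have := hb j
    rw [finrank_baseChange, baseChange_pow_one_tmul] at this
    simpa using this
  choose C hC hb using hcoord
  refine ⟨∑ i, C i * ‖b i‖, Finset.sum_nonneg fun i _ => mul_nonneg (hC i) (norm_nonneg _),
    fun j => ?_⟩
  calc ‖(B ^ j) x‖ = ‖∑ i, b.repr ((B ^ j) x) i • b i‖ := by rw [b.sum_repr]
    _ ≤ ∑ i, |b.repr ((B ^ j) x) i| * ‖b i‖ := by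
        refine (norm_sum_le _ _).trans_eq (Finset.sum_congr rfl fun i _ => ?_)
        rw [norm_smul, Real.norm_eq_abs]
    _ ≤ ∑ i, (C i * ((j : ℝ) + 1) ^ finrank ℝ V * opSpectralRadius B ^ j) * ‖b i‖ := by
        gcongr with i; exact hb i j
    _ = _ := by
        rw [Finset.sum_mul, Finset.sum_mul]
        exact Finset.sum_congr rfl fun i _ => by ring

/-! ### A functional dominating the norm on the cone. -/

/-- A closed salient cone in a finite-dimensional space has a functional bounding the norm. -/
theorem exists_functional_norm_le {E : Type*} [NormedAddCommGroup E] [NormedSpace ℝ E]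
    [FiniteDimensional ℝ E] (K : PointedCone ℝ E) (hclosed : IsClosed (K : Set E))
    (hpointed : (K : ConvexCone ℝ E).Salient) :
    ∃ φ : E →ₗ[ℝ] ℝ, ∃ c : ℝ, 0 < c ∧ ∀ x ∈ K, c * ‖x‖ ≤ φ x := by
  have hsep : ∀ x ∈ (K : Set E) ∩ Metric.sphere 0 1,
      ∃ f : StrongDual ℝ E, (∀ y ∈ K, 0 ≤ f y) ∧ 0 < f x := by
    rintro x ⟨hx, hx1⟩
    have hx0 : x ≠ 0 := by rintro rfl; simp at hx1
    -- Salience says `-x ∉ K`, so `-x` can be separated from `K`. By compactness, finitely many such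
    -- functionals suffice, and their sum is positive on the whole unit slice of `K`.
    obtain ⟨f, hf, hfx⟩ := ProperCone.hyperplane_separation_point
      (C := (⟨K, hclosed⟩ : ProperCone ℝ E)) (x₀ := -x) (hpointed x hx hx0)
    exact ⟨f, hf, by simpa using hfx⟩
  have hcomp : IsCompact ((K : Set E) ∩ Metric.sphere 0 1) :=
    (isCompact_sphere 0 1).inter_left hclosed
  choose! f hf hfx using hsep
  obtain ⟨t, htS, ht⟩ := hcomp.elim_nhds_subcover (fun x => {y | 0 < f x y})
    fun x hx => (isOpen_lt continuous_const (f x).continuous).mem_nhds (hfx x hx)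
  let φ : StrongDual ℝ E := ∑ x ∈ t, f x
  have hφ : ∀ y ∈ (K : Set E) ∩ Metric.sphere 0 1, 0 < φ y := by
    intro y hy
    obtain ⟨x, hx, hxy⟩ := Set.mem_iUnion₂.1 (ht hy)
    simp only [φ, sum_apply]
    exact Finset.sum_pos' (fun z hz => hf z (htS z hz) y hy.1) ⟨x, hx, hxy⟩
  obtain ⟨c, hc, hcφ⟩ : ∃ c : ℝ, 0 < c ∧ ∀ y ∈ (K : Set E) ∩ Metric.sphere 0 1, c ≤ φ y := by
    rcases ((K : Set E) ∩ Metric.sphere 0 1).eq_empty_or_nonempty with h | h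
    · exact ⟨1, one_pos, by simp [h]⟩
    · obtain ⟨y, hy, hmin⟩ := hcomp.exists_isMinOn h φ.continuous.continuousOn
      exact ⟨φ y, hφ y hy, fun z hz => hmin hz⟩
  refine ⟨φ, c, hc, fun x hx => ?_⟩
  by_cases hx0 : x = 0
  · simp [hx0]
  have hn : 0 < ‖x‖ := norm_pos_iff.2 hx0
  have := hcφ (‖x‖⁻¹ • x)
    ⟨K.smul_mem (inv_nonneg.2 hn.le) hx, by simp [norm_smul, hn.ne']⟩
  rw [map_smul, smul_eq_mul, ← div_eq_inv_mul, le_div_iff₀ hn] at this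
  exact this

/-! ### Abel sums and the nonnegative eigenfunctional. -/

section Eigenfunctional

variable {V : Type*} [NormedAddCommGroup V] [NormedSpace ℝ V] [FiniteDimensional ℝ V]

theorem summable_abel (B : V →ₗ[ℝ] V) (hρ : 0 < opSpectralRadius B) (φ : V →ₗ[ℝ] ℝ) {s : ℝ}
    (hs0 : 0 ≤ s) (hs : s * opSpectralRadius B < 1) (x : V) :
    Summable fun j : ℕ => s ^ j * φ ((B ^ j) x) := by
  obtain ⟨C, hC, hb⟩ := exists_norm_pow_apply_le B hρ x
  set ρ := opSpectralRadius B
  set m := finrank ℝ V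
  have h0 : 0 ≤ s * ρ := by positivity
  have hsum : Summable fun j : ℕ => ((j : ℝ) + 1) ^ m * (s * ρ) ^ j := by
    -- The index shift below divides by `s * ρ`, so the value `0` is treated apart.
    rcases h0.eq_or_lt with h | h
    · refine summable_of_ne_finset_zero (s := {0}) fun j hj => ?_
      rw [← h, zero_pow (by simpa using hj), mul_zero]
    · have := (summable_nat_add_iff 1).2 (summable_pow_mul_geometric_of_norm_lt_one m
        (r := s * ρ) (by rwa [Real.norm_of_nonneg h0]))
      refine (this.mul_left (s * ρ)⁻¹).congr fun j => ?_
      push_cast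
      rw [pow_succ' (s * ρ), mul_left_comm, inv_mul_cancel_left₀ h.ne']
  let φ' := LinearMap.toContinuousLinearMap φ
  refine Summable.of_norm_bounded (hsum.mul_left (‖φ'‖ * C)) fun j => ?_
  calc ‖s ^ j * φ ((B ^ j) x)‖ = s ^ j * ‖φ' ((B ^ j) x)‖ := by
        rw [norm_mul, Real.norm_of_nonneg (by positivity)]; rfl
    _ ≤ s ^ j * (‖φ'‖ * (C * ((j : ℝ) + 1) ^ m * ρ ^ j)) := by
        gcongr
        exact (φ'.le_opNorm _).trans (by gcongr; exact hb j)
    _ = _ := by rw [mul_pow]; ring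

/-- The Abel sums `∑ sʲ φ(Bʲ x)` as a linear functional of `x`. -/
theorem exists_abel_functional (B : V →ₗ[ℝ] V) (hρ : 0 < opSpectralRadius B) (φ : V →ₗ[ℝ] ℝ)
    {s : ℝ} (hs0 : 0 ≤ s) (hs : s * opSpectralRadius B < 1) :
    ∃ F : V →ₗ[ℝ] ℝ, (∀ x, HasSum (fun j : ℕ => s ^ j * φ ((B ^ j) x)) (F x)) ∧
      ∀ x, s * F (B x) = F x - φ x := by
  have hsum := summable_abel B hρ φ hs0 hs
  let F : V →ₗ[ℝ] ℝ :=
    { toFun := fun x => ∑' j : ℕ, s ^ j * φ ((B ^ j) x)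
      map_add' := fun x y => by
        rw [← (hsum x).tsum_add (hsum y)]
        simp only [map_add, mul_add]
      map_smul' := fun a x => by
        simp only [map_smul, smul_eq_mul, RingHom.id_apply, ← tsum_mul_left]
        exact tsum_congr fun j => by ring }
  refine ⟨F, fun x => (hsum x).hasSum, fun x => ?_⟩
  have h := (hsum x).tsum_eq_zero_add
  simp only [pow_zero, one_mul, End.one_apply] at h
  change s * ∑' j : ℕ, s ^ j * φ ((B ^ j) (B x)) = (∑' j : ℕ, s ^ j * φ ((B ^ j) x)) - φ x
  rw [h, add_sub_cancel_left, ← tsum_mul_left]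
  refine tsum_congr fun j => ?_
  rw [pow_succ B, End.mul_apply, pow_succ]
  ring

/-- A complex left eigenvector `g` with `‖μ‖ = ρ` is nonzero on some basis vector, and `‖g (B ^ j
x)‖ = ρ ^ j * ‖g x‖`. With a basis taken from the cone, this forces the Abel sums to diverge. -/
theorem exists_orbit_norm_ge (B : V →ₗ[ℝ] V) (hρ : 0 < opSpectralRadius B)
    {ι : Type*} (b : Basis ι ℝ V) :
    ∃ i, ∃ c : ℝ, 0 < c ∧ ∀ j : ℕ, c * opSpectralRadius B ^ j ≤ ‖(B ^ j) (b i)‖ := by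
  obtain ⟨μ, g, hμ, hg, hB⟩ := exists_complex_left_eigenvector B hρ
  obtain ⟨i, hi⟩ : ∃ i, g (b i) ≠ 0 := by
    by_contra! h
    exact hg (b.ext fun i => by simpa using h i)
  have hpow : ∀ j : ℕ, ∀ x, g ((B ^ j) x) = μ ^ j * g x := by
    intro j
    induction j with
    | zero => simp
    | succ j ih => intro x; rw [pow_succ, End.mul_apply, ih, hB, pow_succ, mul_assoc]
  let g' := LinearMap.toContinuousLinearMap g
  have hg' : 0 < ‖g'‖ := norm_pos_iff.2 fun h => hi (by
    have := congrArg (fun k : V →L[ℝ] ℂ => k (b i)) h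
    simpa [g'] using this)
  refine ⟨i, ‖g (b i)‖ / ‖g'‖, div_pos (norm_pos_iff.2 hi) hg', fun j => ?_⟩
  have h1 : ‖g ((B ^ j) (b i))‖ ≤ ‖g'‖ * ‖(B ^ j) (b i)‖ := g'.le_opNorm _
  rw [hpow, norm_mul, norm_pow, hμ] at h1
  rw [div_mul_eq_mul_div, div_le_iff₀ hg']
  linarith

/-- A linear operator preserving a generating cone on which some functional dominates the norm
has a nonzero nonnegative left eigenvector for its spectral radius. -/
theorem exists_nonneg_eigenfunctional (C : PointedCone ℝ V)
    (hspan : Submodule.span ℝ (C : Set V) = ⊤) (B : V →ₗ[ℝ] V) (hB : ∀ x ∈ C, B x ∈ C)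
    (φ : V →ₗ[ℝ] ℝ) {c : ℝ} (hc : 0 < c) (hφ : ∀ x ∈ C, c * ‖x‖ ≤ φ x)
    (hρ : 0 < opSpectralRadius B) :
    ∃ f : V →ₗ[ℝ] ℝ, f ≠ 0 ∧ (∀ x ∈ C, 0 ≤ f x) ∧ ∀ x, f (B x) = opSpectralRadius B * f x := by
  have hBpow : ∀ j : ℕ, ∀ x ∈ C, (B ^ j) x ∈ C := by
    intro j
    induction j with
    | zero => simp
    | succ j ih => intro x hx; rw [pow_succ, End.mul_apply]; exact ih _ (hB x hx)
  have hφ0 : ∀ x ∈ C, 0 ≤ φ x := fun x hx => le_trans (by positivity) (hφ x hx)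
  obtain ⟨ι, _, b, hbC⟩ : ∃ (ι : Type _) (_ : Fintype ι) (b : Basis ι ℝ V), ∀ i, b i ∈ C :=
    let b := Basis.ofSpan hspan.ge
    have := Module.Finite.finite_basis b
    ⟨_, Fintype.ofFinite _, b, fun i => Basis.ofSpan_subset hspan.ge (Set.mem_range_self i)⟩
  obtain ⟨i₀, c', hc', hgrow⟩ := exists_orbit_norm_ge B hρ b
  set ρ := opSpectralRadius B
  -- The Abel parameter is `s = t n / ρ`; this choice gives `(1 - t n)⁻¹ = n + 1`, hence the linear
  -- lower bound on `N n`.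
  let t : ℕ → ℝ := fun n => 1 - 1 / ((n : ℝ) + 1)
  have ht0 : ∀ n, 0 ≤ t n := fun n => by
    have : 1 / ((n : ℝ) + 1) ≤ 1 := by
      rw [div_le_one (by positivity)]; linarith [(Nat.cast_nonneg n : (0 : ℝ) ≤ n)]
    simp only [t]; linarith
  have ht1 : ∀ n, t n < 1 := fun n => by
    have : 0 < 1 / ((n : ℝ) + 1) := by positivity
    simp only [t]; linarith
  have htlim : Tendsto t atTop (𝓝 1) := by
    simpa [t] using (tendsto_const_nhds (x := (1 : ℝ))).sub
      (tendsto_one_div_add_atTop_nhds_zero_nat (𝕜 := ℝ))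
  have hF := fun n => exists_abel_functional B hρ φ (s := t n / ρ) (div_nonneg (ht0 n) hρ.le)
    (by rw [div_mul_cancel₀ _ hρ.ne']; exact ht1 n)
  choose F hFsum hFB using hF
  have hF0 : ∀ n, ∀ x ∈ C, 0 ≤ F n x := fun n x hx => (hFsum n x).nonneg fun j =>
    mul_nonneg (pow_nonneg (div_nonneg (ht0 n) hρ.le) j) (hφ0 _ (hBpow j x hx))
  let N : ℕ → ℝ := fun n => ∑ i, F n (b i)
  have hNge : ∀ n : ℕ, c * c' * ((n : ℝ) + 1) ≤ N n := by
    intro n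
    have hgeom := (hasSum_geometric_of_lt_one (ht0 n) (ht1 n)).mul_left (c * c')
    have hle : c * c' * (1 - t n)⁻¹ ≤ F n (b i₀) := by
      refine hasSum_le (fun j => ?_) hgeom (hFsum n (b i₀))
      calc c * c' * t n ^ j = (t n / ρ) ^ j * (c * (c' * ρ ^ j)) := by
            rw [div_pow]; field_simp
        _ ≤ (t n / ρ) ^ j * φ ((B ^ j) (b i₀)) := by
            have := ht0 n
            gcongr
            exact le_trans (by gcongr; exact hgrow j) (hφ _ (hBpow j _ (hbC i₀)))
    have hinv : (1 - t n)⁻¹ = (n : ℝ) + 1 := by simp [t]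
    rw [hinv] at hle
    exact hle.trans (Finset.single_le_sum (f := fun i => F n (b i))
      (fun i _ => hF0 n _ (hbC i)) (Finset.mem_univ i₀))
  have hN : ∀ n, 0 < N n := fun n => lt_of_lt_of_le (by positivity) (hNge n)
  have hNlim : Tendsto N atTop atTop := by
    refine tendsto_atTop_mono hNge (Tendsto.const_mul_atTop (by positivity) ?_)
    exact tendsto_atTop_add_const_right _ _ tendsto_natCast_atTop_atTop
  -- The normalized values on the basis are nonnegative and sum to `1`: they stay in a compact cube,
  -- and their limit cannot vanish.
  let p : ℕ → ι → ℝ := fun n i => F n (b i) / N n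
  have hp : ∀ n, p n ∈ Set.Icc (0 : ι → ℝ) 1 := fun n =>
    ⟨fun i => div_nonneg (hF0 n _ (hbC i)) (hN n).le, fun i => (div_le_one (hN n)).2
      (Finset.single_le_sum (f := fun i => F n (b i))
        (fun i _ => hF0 n _ (hbC i)) (Finset.mem_univ i))⟩
  obtain ⟨q, -, ψ, hψ, hq⟩ := isCompact_Icc.tendsto_subseq hp
  let f : V →ₗ[ℝ] ℝ := b.constr ℝ q
  have hfb : ∀ i, f (b i) = q i := fun i => b.constr_basis ℝ q i
  have hqi := tendsto_pi_nhds.1 hq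
  have hlim : ∀ x, Tendsto (fun n => F (ψ n) x / N (ψ n)) atTop (𝓝 (f x)) := by
    intro x
    have h1 : ∀ g : V →ₗ[ℝ] ℝ, g x = ∑ i, b.repr x i * g (b i) := fun g => by
      conv_lhs => rw [← b.sum_repr x]
      rw [map_sum]
      simp only [map_smul, smul_eq_mul]
    rw [h1 f]
    refine (tendsto_finsetSum Finset.univ fun i _ =>
      (hqi i).const_mul (b.repr x i)).congr' (Eventually.of_forall fun n => ?_) |>.trans_eq ?_
    · rw [h1 (F (ψ n)), Finset.sum_div]
      exact Finset.sum_congr rfl fun i _ => by simp only [p, Function.comp]; ring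
    · simp only [hfb]
  refine ⟨f, ?_, fun x hx => ge_of_tendsto' (hlim x) fun n =>
    div_nonneg (hF0 _ x hx) (hN _).le, fun x => ?_⟩
  · intro h0
    have h1 : Tendsto (fun n => ∑ i, p (ψ n) i) atTop (𝓝 (∑ i, q i)) :=
      tendsto_finsetSum _ fun i _ => hqi i
    have h2 : ∀ n, ∑ i, p (ψ n) i = 1 := fun n => by
      simp only [p, ← Finset.sum_div]; exact div_self (hN _).ne'
    simp only [h2, ← hfb, h0, LinearMap.zero_apply, Finset.sum_const_zero] at h1
    exact one_ne_zero (tendsto_nhds_unique tendsto_const_nhds h1)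
  -- Divide `s * F (B x) = F x - φ x` by `N` and pass to the limit; the `φ` term vanishes since `N →
  -- ∞`.
  · have h1 := (((htlim.comp hψ.tendsto_atTop).div_const ρ).mul (hlim (B x)))
    have h2 := (hlim x).sub ((tendsto_const_nhds (x := φ x)).div_atTop
      (hNlim.comp hψ.tendsto_atTop))
    have h3 : 1 / ρ * f (B x) = f x - 0 := by
      refine tendsto_nhds_unique h1 (h2.congr fun n => ?_)
      simp only [Function.comp]
      rw [← sub_div, ← hFB, mul_div_assoc]
    rw [sub_zero, one_div, inv_mul_eq_iff_eq_mul₀ hρ.ne'] at h3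
    exact h3

end Eigenfunctional

/-! ### Minimality of the face and the main theorem. -/

/-- A functional nonnegative on the minimal invariant face and invariant up to a factor vanishes on
the span of that face as soon as it vanishes on the generating set. -/
theorem IsMinimalInvariantFace.eq_zero_of_forall_mem {E : Type*} [AddCommGroup E] [Module ℝ E]
    {K : PointedCone ℝ E} {A : E →ₗ[ℝ] E} {Γ : Set E} {L : PointedCone ℝ E}
    (hL : IsMinimalInvariantFace K A Γ L) (f : E →ₗ[ℝ] ℝ) (hf : ∀ x ∈ L, 0 ≤ f x) {ρ : ℝ}
    (hfA : ∀ x ∈ L, f (A x) = ρ * f x) (hΓ : ∀ x ∈ Γ, f x = 0) : ∀ x ∈ L, f x = 0 := by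
  obtain ⟨⟨⟨hface, hinv⟩, hsub⟩, hmin⟩ := hL
  let F : PointedCone ℝ E := L ⊓ (LinearMap.ker f).restrictScalars _
  have hmem : ∀ x, x ∈ F ↔ x ∈ L ∧ f x = 0 := fun x => Iff.rfl
  have hF : F.IsFaceOf L := by
    refine ⟨fun x hx => hx.1, fun {x y a} hx hy ha h => ⟨hx, ?_⟩⟩
    -- Two nonnegative terms with zero sum both vanish, so the zeros of `f` form a face of `L`, and
    -- by transitivity a face of `K`.
    have h0 : a * f x + f y = 0 := by simpa using ((hmem _).1 h).2
    have h1 : a * f x = 0 := by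
      have := mul_nonneg ha.le (hf x hx)
      linarith [hf y hy]
    exact (mul_eq_zero.1 h1).resolve_left ha.ne'
  have hle : L ≤ F := hmin ⟨⟨hF.trans hface, fun x hx => (hmem _).2 ⟨hinv x hx.1, by
    rw [hfA x hx.1, ((hmem x).1 hx).2, mul_zero]⟩⟩, fun x hx => (hmem x).2 ⟨hsub hx, hΓ x hx⟩⟩
  exact fun x hx => ((hmem x).1 (hle hx)).2

theorem coe_restrict_pow_apply {E : Type*} [AddCommGroup E] [Module ℝ E] {A : E →ₗ[ℝ] E}
    {V : Submodule ℝ E} (hV : ∀ x ∈ V, A x ∈ V) (j : ℕ) (x : V) :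
    (((A.restrict hV) ^ j) x : E) = (A ^ j) x := by
  induction j generalizing x with
  | zero => simp
  | succ j ih => rw [pow_succ, pow_succ, End.mul_apply, End.mul_apply, ih]; rfl

theorem exists_orbit_norm_ge_of_isMinimalInvariantFace {E : Type*} [NormedAddCommGroup E]
    [NormedSpace ℝ E] [FiniteDimensional ℝ E] {K : PointedCone ℝ E}
    (hclosed : IsClosed (K : Set E)) (hpointed : (K : ConvexCone ℝ E).Salient)
    {A : E →ₗ[ℝ] E} {Γ : Set E} {L : PointedCone ℝ E}
    (hL : IsMinimalInvariantFace K A Γ L) (hρ : 0 < faceSpectralRadius hL.1.1) :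
    ∃ x₀ ∈ Γ, ∃ C : ℝ, 0 < C ∧ ∀ j : ℕ, C * faceSpectralRadius hL.1.1 ^ j ≤ ‖(A ^ j) x₀‖ := by
  obtain ⟨φ, c, hc, hφ⟩ := exists_functional_norm_le K hclosed hpointed
  let V := Submodule.span ℝ (L : Set E)
  let B : V →ₗ[ℝ] V := A.restrict hL.1.1.span_invariant
  have hLV : ∀ x ∈ L, x ∈ V := fun x hx => Submodule.subset_span hx
  let C : PointedCone ℝ V := PointedCone.comap V.subtype L
  have hspan : Submodule.span ℝ (C : Set V) = ⊤ :=
    Submodule.span_span_coe_preimage (R := ℝ) (s := (L : Set E))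
  obtain ⟨f₀, hf₀, hpos, heig⟩ := exists_nonneg_eigenfunctional C hspan B
    (fun x hx => hL.1.1.2 x hx) (φ ∘ₗ V.subtype) hc
    (fun x hx => hφ x (hL.1.1.1.le hx)) hρ
  -- The minimality lemma takes functionals on all of `E`. Any extension serves, since only its
  -- values on the span of `L` matter.
  obtain ⟨f, hf⟩ := LinearMap.exists_extend f₀
  have hfV : ∀ x : V, f x = f₀ x := fun x => LinearMap.congr_fun hf x
  have heigV : ∀ x ∈ V, f (A x) = faceSpectralRadius hL.1.1 * f x := fun x hx => by
    rw [hfV ⟨x, hx⟩]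
    exact (hfV (B ⟨x, hx⟩)).trans (heig ⟨x, hx⟩)
  have hnonneg : ∀ x ∈ L, 0 ≤ f x := fun x hx => by
    rw [hfV ⟨x, hLV x hx⟩]; exact hpos ⟨x, hLV x hx⟩ hx
  obtain ⟨x₀, hx₀, hne⟩ : ∃ x₀ ∈ Γ, f x₀ ≠ 0 := by
    by_contra! h
    have h0 := hL.eq_zero_of_forall_mem f hnonneg (fun x hx => heigV x (hLV x hx)) h
    refine hf₀ (LinearMap.ext_on hspan fun x hx => ?_)
    rw [← hfV, h0 x hx, LinearMap.zero_apply]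
  have hx₀V : x₀ ∈ V := hLV _ (hL.1.2 hx₀)
  have hpow : ∀ j : ℕ, f ((A ^ j) x₀) = faceSpectralRadius hL.1.1 ^ j * f x₀ ∧ (A ^ j) x₀ ∈ V := by
    intro j
    induction j with
    | zero => simpa using hx₀V
    | succ j ih =>
      rw [pow_succ', End.mul_apply]
      exact ⟨by rw [heigV _ ih.2, ih.1]; ring, hL.1.1.span_invariant _ ih.2⟩
  let f' := LinearMap.toContinuousLinearMap f
  have hf' : 0 < ‖f'‖ := norm_pos_iff.2 fun h => hne (by
    have := congrArg (fun k : E →L[ℝ] ℝ => k x₀) h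
    simpa [f'] using this)
  refine ⟨x₀, hx₀, f x₀ / ‖f'‖, div_pos ((hnonneg _ (hL.1.2 hx₀)).lt_of_ne' hne) hf', fun j => ?_⟩
  rw [div_mul_eq_mul_div, div_le_iff₀ hf', mul_comm (f x₀), ← (hpow j).1, mul_comm]
  exact (le_abs_self _).trans (f'.le_opNorm _)

theorem theorem3p1 {d : ℕ}
    (K : PointedCone ℝ (EuclideanSpace ℝ (Fin d)))
    (hclosed : IsClosed (K : Set (EuclideanSpace ℝ (Fin d))))
    (hsolid : (interior (K : Set (EuclideanSpace ℝ (Fin d)))).Nonempty)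
    (hpointed : (K : ConvexCone ℝ (EuclideanSpace ℝ (Fin d))).Salient)
    (A : EuclideanSpace ℝ (Fin d) →ₗ[ℝ] EuclideanSpace ℝ (Fin d))
    (hA : ∀ x ∈ K, A x ∈ K)
    (Γ : Set (EuclideanSpace ℝ (Fin d)))
    (hΓ : Γ ⊆ (K : Set (EuclideanSpace ℝ (Fin d)))) (hne : Γ.Nonempty)
    (L : PointedCone ℝ (EuclideanSpace ℝ (Fin d)))
    (hL : IsMinimalInvariantFace K A Γ L) :
    (0 < faceSpectralRadius hL.1.1 →
      ∀ x ∈ Γ, ∃ r : ℝ, 0 < r ∧ ∃ C : ℝ, 0 < C ∧ ∀ j : ℕ, 1 ≤ j →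
        ‖(A ^ j) x‖ ≤ C * (j : ℝ) ^ r * faceSpectralRadius hL.1.1 ^ j) ∧
    (faceSpectralRadius hL.1.1 = 0 → ∀ x ∈ Γ, ∀ j : ℕ, d ≤ j → (A ^ j) x = 0) ∧
    (∃ x₀ ∈ Γ, ∃ C : ℝ, 0 < C ∧ ∀ j : ℕ, 1 ≤ j →
      C * faceSpectralRadius hL.1.1 ^ j ≤ ‖(A ^ j) x₀‖) := by
  have hΓV : ∀ x ∈ Γ, x ∈ Submodule.span ℝ (L : Set (EuclideanSpace ℝ (Fin d))) :=
    fun x hx => Submodule.subset_span (hL.1.2 hx)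
  refine ⟨fun hρ x hx => ?_, fun hρ x hx j hj => ?_, ?_⟩
  · obtain ⟨C, hC, hb⟩ := exists_norm_pow_apply_le _ hρ ⟨x, hΓV x hx⟩
    set m := finrank ℝ (Submodule.span ℝ (L : Set (EuclideanSpace ℝ (Fin d))))
    -- `2 ^ m` comes from `j + 1 ≤ 2 * j` for `j ≥ 1`. The extra `1` in the exponent and in the
    -- constant makes both visibly positive.
    refine ⟨(m + 1 : ℕ), by positivity, C * 2 ^ m + 1, by positivity, fun j hj => ?_⟩
    have hj1 : (1 : ℝ) ≤ j := by exact_mod_cast hj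
    have hbj := hb j
    rw [← Submodule.norm_coe, coe_restrict_pow_apply] at hbj
    refine hbj.trans (mul_le_mul_of_nonneg_right ?_ (pow_nonneg hρ.le j))
    rw [Real.rpow_natCast]
    calc C * ((j : ℝ) + 1) ^ m ≤ C * (2 * j) ^ m := by gcongr; linarith
      _ = C * 2 ^ m * (j : ℝ) ^ m := by rw [mul_pow]; ring
      _ ≤ (C * 2 ^ m + 1) * (j : ℝ) ^ (m + 1) := by
          gcongr
          · linarith
          · omega
  · have h := pow_finrank_eq_zero_of_opSpectralRadius_eq_zero _ hρ
    have hle : finrank ℝ (Submodule.span ℝ (L : Set (EuclideanSpace ℝ (Fin d)))) ≤ j := by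
      refine le_trans ?_ hj
      simpa using Submodule.finrank_le (Submodule.span ℝ (L : Set (EuclideanSpace ℝ (Fin d))))
    have hz := pow_eq_zero_of_le hle h
    have := coe_restrict_pow_apply hL.1.1.span_invariant j ⟨x, hΓV x hx⟩
    rw [hz] at this
    simpa using this.symm
  · rcases (opSpectralRadius_nonneg (A.restrict hL.1.1.span_invariant)).eq_or_lt with h | h
    -- For `ρ = 0` the bound is trivial at every point of `Γ`, because `0 ^ j = 0` for `j ≥ 1`.
    · obtain ⟨x, hx⟩ := hne
      refine ⟨x, hx, 1, one_pos, fun j hj => ?_⟩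
      have h0 : faceSpectralRadius hL.1.1 = 0 := h.symm
      rw [h0, zero_pow (by omega), mul_zero]
      exact norm_nonneg _
    · obtain ⟨x₀, hx₀, C, hC, hb⟩ :=
        exists_orbit_norm_ge_of_isMinimalInvariantFace hclosed hpointed hL h
      exact ⟨x₀, hx₀, C, hC, fun j _ => hb j⟩
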